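/- Let $R$ be an associative ring with unit. An $R$-algebra is a ring $S$ together with a ring homomorphism $R\to S$ (not necessarily with central image). A functor of $\mathcal R$-modules is a covariant functor $\mathbb F$ from $R$-algebras to abelian groups together with a functorial left $S$-module structure on $\mathbb F(S)$ for every $R$-algebra $S$; morphisms are natural transformations that are $S$-linear for every $S$. Functors of right $\mathcal R$-modules are defined likewise. For a left $R$-module $M$ let $\mathcal M$ be the functor of $\mathcal R$-modules $\mathcal M(S)=S\otimes_R M$; for a right $R$-module $N$ let $\mathcal N$ be the functor of right $\mathcal R$-modules $\mathcal N(S)=N\otimes_R S$, and let $\mathcal N^\vee$ be its dual, the functor of $\mathcal R$-modules $\mathcal N^\vee(S)=\operatorname{Hom}_{\mathcal R}(\mathcal N,\mathcal S)$, where $\mathcal S(T)=S\otimes_R T$ and $S$ acts through left multiplication on $S$. A functor of $\mathcal R$-modules is a module scheme if it is isomorphic to $\mathcal N^\vee$ for some right $R$-module $N$. For a right $R$-module $N$ let $R\langle N\rangle=T_R(R\otimes_{\mathbb Z}N)$ be the $R$-algebra generated by $N$, so that $\operatorname{Hom}_{R\text{-alg}}(R\langle N\rangle,S)=\operatorname{Hom}_R(N,S)$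 for every $R$-algebra $S$, and let $\mathrm{in},h_x\colon R\langle N\rangle\to R\langle N\oplus xR\rangle$ be the morphisms of $R$-algebras with $\mathrm{in}(n)=n$ and $h_x(n)=x\cdot n$ for $n\in N$. Put $$\mathcal M^r(N)=\ker\bigl(\mathcal M(h_x)-x\cdot\mathcal M(\mathrm{in})\colon \mathcal M(R\langle N\rangle)\to\mathcal M(R\langle N\oplus xR\rangle)\bigr),\qquad \mathcal M_r(N)=N\otimes_R M.$$ There is a natural morphism $\mathcal M_r\to\mathcal M^r$ of functors from right $R$-modules to abelian groups, given by $N\otimes_R M\to\mathcal M^r(N)\subseteq R\langle N\rangle\otimes_R M$, $n\otimes m\mapsto n\otimes m$. **Theorem.** Let $M$ be a left $R$-module such that $\mathcal M_r=\mathcal M^r$, that is, such that the natural morphism $\mathcal M_r\to\mathcal M^r$ is an isomorphism. Then $M$ is a finitely generated projective $R$-module if and only if $\mathcal M$ is a module scheme. -/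

import Mathlib

universe u v w

open CategoryTheory MulOpposite
open scoped TensorProduct

namespace RMod

/-! ### Tensor product over a (not necessarily commutative) ring -/

section BalancedTensor

variable (R : Type u) [Ring R]

/-- The subgroup of `N ⊗_ℤ M` generated by the elements `n r ⊗ m - n ⊗ r m`. -/
def balancedRel (N : Type v) [AddCommGroup N] [Module Rᵐᵒᵖ N]
    (M : Type w) [AddCommGroup M] [Module R M] : AddSubgroup (N ⊗[ℤ] M) :=
  AddSubgroup.closure {x | ∃ (n : N) (r : R) (m : M), x = (op r • n) ⊗ₜ[ℤ] m - n ⊗ₜ[ℤ] (r • m)}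

/-- The tensor product `N ⊗_R M` of a right `R`-module `N` and a left `R`-module `M` over an
arbitrary ring `R`.  Right `R`-modules are modules over the opposite ring `Rᵐᵒᵖ`. -/
def BalTensor (N : Type v) [AddCommGroup N] [Module Rᵐᵒᵖ N]
    (M : Type w) [AddCommGroup M] [Module R M] : Type (max v w) :=
  (N ⊗[ℤ] M) ⧸ balancedRel R N M

namespace BalTensor

variable {N : Type v} [AddCommGroup N] [Module Rᵐᵒᵖ N]
  {M : Type w} [AddCommGroup M] [Module R M]

instance : AddCommGroup (BalTensor R N M) :=
  inferInstanceAs (AddCommGroup ((N ⊗[ℤ] M) ⧸ balancedRel R N M))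

/-- The pure tensor `n ⊗ m` in `N ⊗_R M`. -/
def tmul (n : N) (m : M) : BalTensor R N M :=
  QuotientAddGroup.mk' (balancedRel R N M) (n ⊗ₜ[ℤ] m)

theorem add_tmul (n n' : N) (m : M) : tmul R (n + n') m = tmul R n m + tmul R n' m := by
  simp only [tmul, TensorProduct.add_tmul, map_add]
  rfl

theorem tmul_add (n : N) (m m' : M) : tmul R n (m + m') = tmul R n m + tmul R n m' := by
  simp only [tmul, TensorProduct.tmul_add, map_add]
  rfl

theorem smul_tmul (n : N) (r : R) (m : M) : tmul R (op r • n) m = tmul R n (r • m) := by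
  have h : (op r • n) ⊗ₜ[ℤ] m - n ⊗ₜ[ℤ] (r • m) ∈ balancedRel R N M :=
    AddSubgroup.subset_closure ⟨n, r, m, rfl⟩
  have h2 := (QuotientAddGroup.eq_zero_iff _).2 h
  exact sub_eq_zero.1 h2

variable {R}

/-- Universal property of `N ⊗_R M`: balanced biadditive maps factor through it. -/
def lift {A : Type*} [AddCommGroup A] (f : N →+ M →+ A)
    (hf : ∀ (n : N) (r : R) (m : M), f (op r • n) m = f n (r • m)) : BalTensor R N M →+ A :=
  QuotientAddGroup.lift (balancedRel R N M)
    (TensorProduct.liftAddHom f fun k n m => by simp [map_zsmul])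
    ((AddSubgroup.closure_le _).2 (by
      rintro _ ⟨n, r, m, rfl⟩
      simp only [SetLike.mem_coe, AddMonoidHom.mem_ker, map_sub, TensorProduct.liftAddHom_tmul,
        hf, sub_self]))

@[simp]
theorem lift_tmul {A : Type*} [AddCommGroup A] (f : N →+ M →+ A)
    (hf : ∀ (n : N) (r : R) (m : M), f (op r • n) m = f n (r • m)) (n : N) (m : M) :
    lift f hf (tmul R n m) = f n m := rfl

theorem hom_ext {A : Type*} [AddCommGroup A] {f g : BalTensor R N M →+ A}
    (h : ∀ n m, f (tmul R n m) = g (tmul R n m)) : f = g := by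
  ext x
  obtain ⟨y, rfl⟩ := QuotientAddGroup.mk'_surjective (balancedRel R N M) x
  induction y with
  | zero => rw [map_zero]; exact (map_zero f).trans (map_zero g).symm
  | tmul n m => exact h n m
  | add a b ha hb =>
    rw [map_add]
    exact (map_add f _ _).trans ((congrArg₂ _ ha hb).trans (map_add g _ _).symm)

variable {N' : Type*} [AddCommGroup N'] [Module Rᵐᵒᵖ N'] {M' : Type*} [AddCommGroup M'] [Module R M']
  {N'' : Type*} [AddCommGroup N''] [Module Rᵐᵒᵖ N'']
  {M'' : Type*} [AddCommGroup M''] [Module R M'']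

/-- The map `f ⊗ g` induced by a right `R`-linear `f` and a left `R`-linear `g`. -/
def map (f : N →ₗ[Rᵐᵒᵖ] N') (g : M →ₗ[R] M') : BalTensor R N M →+ BalTensor R N' M' :=
  lift
    (AddMonoidHom.mk' (fun n => AddMonoidHom.mk' (fun m => tmul R (f n) (g m))
        fun m m' => by rw [map_add, tmul_add])
      fun n n' => by ext m; simp [add_tmul])
    fun n r m => by simp [smul_tmul]

@[simp]
theorem map_tmul (f : N →ₗ[Rᵐᵒᵖ] N') (g : M →ₗ[R] M') (n : N) (m : M) :
    map f g (tmul R n m) = tmul R (f n) (g m) := rfl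

theorem map_id : map (LinearMap.id : N →ₗ[Rᵐᵒᵖ] N) (LinearMap.id : M →ₗ[R] M) =
    AddMonoidHom.id _ := hom_ext fun _ _ => rfl

theorem map_comp (f' : N' →ₗ[Rᵐᵒᵖ] N'') (f : N →ₗ[Rᵐᵒᵖ] N') (g' : M' →ₗ[R] M'')
    (g : M →ₗ[R] M') : map (f' ∘ₗ f) (g' ∘ₗ g) = (map f' g').comp (map f g) :=
  hom_ext fun _ _ => rfl

theorem map_add_left (f f' : N →ₗ[Rᵐᵒᵖ] N') (g : M →ₗ[R] M') :
    map (f + f') g = map f g + map f' g :=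
  hom_ext fun n m => by simp [add_tmul]

theorem map_add_right (f : N →ₗ[Rᵐᵒᵖ] N') (g g' : M →ₗ[R] M') :
    map f (g + g') = map f g + map f g' :=
  hom_ext fun n m => by simp [tmul_add]

theorem map_zero_left (g : M →ₗ[R] M') : map (0 : N →ₗ[Rᵐᵒᵖ] N') g = 0 := by
  simpa using map_add_left (0 : N →ₗ[Rᵐᵒᵖ] N') 0 g

theorem map_zero_right (f : N →ₗ[Rᵐᵒᵖ] N') : map f (0 : M →ₗ[R] M') = 0 := by
  simpa using map_add_right f (0 : M →ₗ[R] M') 0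

variable (R N M)

/-- If `S` acts on `N` on the left, commuting with the right action of `R`, then `S` acts on
`N ⊗_R M` by `s (n ⊗ m) = (s n) ⊗ m`. -/
abbrev moduleLeft (S : Type*) [Ring S] [Module S N] [SMulCommClass S Rᵐᵒᵖ N] :
    Module S (BalTensor R N M) :=
  Module.compHom (BalTensor R N M)
    ({ toFun := fun s => map (DistribSMul.toLinearMap Rᵐᵒᵖ N s) LinearMap.id
       map_one' := hom_ext fun n m => congrArg (tmul R · m) (one_smul S n)
       map_mul' := fun s t => hom_ext fun n m => congrArg (tmul R · m) (mul_smul s t n)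
       map_zero' := hom_ext fun n m => by
        have h : (DistribSMul.toLinearMap Rᵐᵒᵖ N (0 : S)) = 0 := by ext; simp
        rw [h, map_zero_left]; rfl
       map_add' := fun s t => hom_ext fun n m =>
        (congrArg (tmul R · m) (add_smul s t n)).trans (add_tmul R (s • n) (t • n) m) } :
      S →+* AddMonoid.End (BalTensor R N M))

/-- If `T` acts on `M`, commuting with the left action of `R`, then `T` acts on
`N ⊗_R M` by the action on `M`.  It is used with `T` an opposite ring: a right action on `M`
gives a right action `(n ⊗ m) t = n ⊗ (m t)`. -/
abbrev moduleRight (T : Type*) [Ring T] [Module T M] [SMulCommClass T R M] :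
    Module T (BalTensor R N M) :=
  Module.compHom (BalTensor R N M)
    ({ toFun := fun t => map LinearMap.id (DistribSMul.toLinearMap R M t)
       map_one' := hom_ext fun n m => congrArg (tmul R n ·) (one_smul T m)
       map_mul' := fun s t => hom_ext fun n m => congrArg (tmul R n ·) (mul_smul s t m)
       map_zero' := hom_ext fun n m => by
        have h : (DistribSMul.toLinearMap R M (0 : T)) = 0 := by ext; simp
        rw [h, map_zero_right]; rfl
       map_add' := fun s t => hom_ext fun n m =>
        (congrArg (tmul R n ·) (add_smul s t m)).trans (tmul_add R n (s • m) (t • m)) } :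
      T →+* AddMonoid.End (BalTensor R N M))

end BalTensor

end BalancedTensor

/-! ### `R`-algebras -/

/-- The category of `R`-algebras, for an arbitrary ring `R`: rings `S` with a ring homomorphism
`R → S` (whose image need not be central), and ring homomorphisms under `R`. -/
abbrev RAlg (R : Type u) [Ring R] := Under (RingCat.of R)

namespace RAlg

variable {R : Type u} [Ring R]

/-- The structure homomorphism `R → S` of an `R`-algebra `S`. -/
def algMap (S : RAlg R) : R →+* S.right := S.hom.hom

/-- The left `R`-module underlying an `R`-algebra. -/
instance leftModule (S : RAlg R) : Module R S.right :=
  Module.compHom S.right (algMap S)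

/-- The right `R`-module underlying an `R`-algebra. -/
instance rightModule (S : RAlg R) : Module Rᵐᵒᵖ S.right :=
  Module.compHom S.right (RingHom.op (algMap S))

theorem smul_def (S : RAlg R) (r : R) (s : S.right) : r • s = algMap S r * s := rfl

theorem op_smul_def (S : RAlg R) (r : R) (s : S.right) : op r • s = s * algMap S r := rfl

instance (S : RAlg R) : SMulCommClass S.right Rᵐᵒᵖ S.right where
  smul_comm s r t := by
    obtain ⟨r, rfl⟩ := op_surjective r
    simp only [smul_eq_mul, op_smul_def, mul_assoc]

instance (S : RAlg R) : SMulCommClass S.rightᵐᵒᵖ R S.right where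
  smul_comm s r t := by
    simp only [smul_def, mul_assoc, MulOpposite.smul_eq_mul_unop]

theorem hom_comm {S T : RAlg R} (f : S ⟶ T) (r : R) : f.right.hom (algMap S r) = algMap T r := by
  rw [algMap, algMap, ← Under.w f]; rfl

/-- A morphism of `R`-algebras as a map of left `R`-modules. -/
def homLeft {S T : RAlg R} (f : S ⟶ T) : S.right →ₗ[R] T.right where
  toFun := f.right.hom
  map_add' := map_add _
  map_smul' r s := by simp only [smul_def, map_mul, hom_comm, RingHom.id_apply]

/-- A morphism of `R`-algebras as a map of right `R`-modules. -/
def homRight {S T : RAlg R} (f : S ⟶ T) : S.right →ₗ[Rᵐᵒᵖ] T.right where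
  toFun := f.right.hom
  map_add' := map_add _
  map_smul' r s := by
    obtain ⟨r, rfl⟩ := op_surjective r
    simp only [op_smul_def, map_mul, hom_comm, RingHom.id_apply]

/-- Left multiplication by `s` on an `R`-algebra, a map of right `R`-modules. -/
def mulLeft (S : RAlg R) (s : S.right) : S.right →ₗ[Rᵐᵒᵖ] S.right :=
  DistribSMul.toLinearMap Rᵐᵒᵖ S.right s

@[simp] theorem homLeft_apply {S T : RAlg R} (f : S ⟶ T) (s : S.right) :
    homLeft f s = f.right.hom s := rfl

@[simp] theorem homRight_apply {S T : RAlg R} (f : S ⟶ T) (s : S.right) :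
    homRight f s = f.right.hom s := rfl

@[simp] theorem mulLeft_apply (S : RAlg R) (s t : S.right) : mulLeft S s t = s * t := rfl

end RAlg

/-! ### Functors of (left and right) modules over the functor of rings `S ↦ S` -/

/-- A functor of `𝓡`-modules: a functor from `R`-algebras to abelian groups with an
`S`-module structure on the value at each `S`, functorial in `S`. -/
structure ModFunctor (R : Type u) [Ring R] where
  toFunctor : RAlg R ⥤ AddCommGrpCat.{v}
  module : ∀ S : RAlg R, Module S.right (toFunctor.obj S)
  map_smul : ∀ {S T : RAlg R} (f : S ⟶ T) (s : S.right) (x : toFunctor.obj S),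
    (toFunctor.map f).hom (s • x) = f.right.hom s • (toFunctor.map f).hom x

/-- A functor of right `𝓡`-modules. -/
structure RightModFunctor (R : Type u) [Ring R] where
  toFunctor : RAlg R ⥤ AddCommGrpCat.{v}
  module : ∀ S : RAlg R, Module S.rightᵐᵒᵖ (toFunctor.obj S)
  map_smul : ∀ {S T : RAlg R} (f : S ⟶ T) (s : S.right) (x : toFunctor.obj S),
    (toFunctor.map f).hom (op s • x) = op (f.right.hom s) • (toFunctor.map f).hom x

attribute [instance] ModFunctor.module RightModFunctor.module

section Functors

variable {R : Type u} [Ring R]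

/-- An isomorphism of functors of `𝓡`-modules: `S`-linear bijections natural in `S`.  The two
functors may take values in different universes. -/
structure ModFunctor.Iso (F : ModFunctor.{u, v} R) (G : ModFunctor.{u, w} R) where
  app : ∀ S : RAlg R, F.toFunctor.obj S ≃ₗ[S.right] G.toFunctor.obj S
  naturality : ∀ {S T : RAlg R} (f : S ⟶ T) (x : F.toFunctor.obj S),
    app T ((F.toFunctor.map f).hom x) = (G.toFunctor.map f).hom (app S x)

/-- A morphism of functors of right `𝓡`-modules. -/
@[ext]
structure RightModFunctor.Hom (F : RightModFunctor.{u, v} R) (G : RightModFunctor.{u, w} R) where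
  app : ∀ S : RAlg R, F.toFunctor.obj S →ₗ[S.rightᵐᵒᵖ] G.toFunctor.obj S
  naturality : ∀ {S T : RAlg R} (f : S ⟶ T) (x : F.toFunctor.obj S),
    app T ((F.toFunctor.map f).hom x) = (G.toFunctor.map f).hom (app S x)

namespace RightModFunctor.Hom

variable {F : RightModFunctor.{u, v} R} {G H : RightModFunctor.{u, w} R}

/-- Composition of morphisms of functors of right `𝓡`-modules. -/
def comp (ψ : Hom G H) (φ : Hom F G) : Hom F H where
  app S := ψ.app S ∘ₗ φ.app S
  naturality f x := by simp [φ.naturality, ψ.naturality]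

instance : Zero (Hom F G) := ⟨{ app := fun _ => 0, naturality := by simp }⟩

instance : Add (Hom F G) :=
  ⟨fun φ ψ => { app := fun S => φ.app S + ψ.app S
                naturality := fun f x => by simp [φ.naturality, ψ.naturality] }⟩

instance : Neg (Hom F G) :=
  ⟨fun φ => { app := fun S => -φ.app S
              naturality := fun f x => by simp [φ.naturality] }⟩

instance : AddCommGroup (Hom F G) where
  add_assoc _ _ _ := Hom.ext (funext fun _ => add_assoc _ _ _)
  zero_add _ := Hom.ext (funext fun _ => zero_add _)
  add_zero _ := Hom.ext (funext fun _ => add_zero _)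
  neg_add_cancel _ := Hom.ext (funext fun _ => neg_add_cancel _)
  add_comm _ _ := Hom.ext (funext fun _ => add_comm _ _)
  nsmul := nsmulRec
  zsmul := zsmulRec

end RightModFunctor.Hom

/-- The quasi-coherent `𝓡`-module `𝓜` associated with a left `R`-module `M`: `𝓜(S) = S ⊗_R M`. -/
def quasiCoherent (M : Type u) [AddCommGroup M] [Module R M] : ModFunctor.{u, u} R where
  toFunctor :=
    { obj := fun S => AddCommGrpCat.of (BalTensor R S.right M)
      map := fun f => AddCommGrpCat.ofHom (BalTensor.map (RAlg.homRight f) LinearMap.id)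
      map_id := fun S => by
        ext1
        exact BalTensor.hom_ext fun _ _ => rfl
      map_comp := fun f g => by
        ext1
        exact BalTensor.hom_ext fun _ _ => rfl }
  module S := BalTensor.moduleLeft R S.right M S.right
  map_smul {S T} f s x := by
    refine DFunLike.congr_fun
      (f := (BalTensor.map (RAlg.homRight f) LinearMap.id).comp
        (BalTensor.map (RAlg.mulLeft S s) (LinearMap.id : M →ₗ[R] M)))
      (g := (BalTensor.map (RAlg.mulLeft T (f.right.hom s)) LinearMap.id).comp
        (BalTensor.map (RAlg.homRight f) (LinearMap.id : M →ₗ[R] M)))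
      (BalTensor.hom_ext fun n m => ?_) x
    simp

/-- The quasi-coherent right `𝓡`-module `𝓝` associated with a right `R`-module `N`:
`𝓝(S) = N ⊗_R S`. -/
def quasiCoherentRight (N : Type u) [AddCommGroup N] [Module Rᵐᵒᵖ N] :
    RightModFunctor.{u, u} R where
  toFunctor :=
    { obj := fun S => AddCommGrpCat.of (BalTensor R N S.right)
      map := fun f => AddCommGrpCat.ofHom (BalTensor.map LinearMap.id (RAlg.homLeft f))
      map_id := fun S => by
        ext1
        exact BalTensor.hom_ext fun _ _ => rfl
      map_comp := fun f g => by
        ext1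
        exact BalTensor.hom_ext fun _ _ => rfl }
  module S := BalTensor.moduleRight R N S.right S.rightᵐᵒᵖ
  map_smul {S T} f s x := by
    refine DFunLike.congr_fun
      (f := (BalTensor.map LinearMap.id (RAlg.homLeft f)).comp
        (BalTensor.map (LinearMap.id : N →ₗ[Rᵐᵒᵖ] N) (DistribSMul.toLinearMap R S.right (op s))))
      (g := (BalTensor.map LinearMap.id
          (DistribSMul.toLinearMap R T.right (op (f.right.hom s)))).comp
        (BalTensor.map (LinearMap.id : N →ₗ[Rᵐᵒᵖ] N) (RAlg.homLeft f)))
      (BalTensor.hom_ext fun n m => ?_) x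
    simp

/-- A right `R`-linear map `N → N'` induces a morphism `𝓝 → 𝓝'`. -/
def quasiCoherentRightMap {N N' : Type u} [AddCommGroup N] [Module Rᵐᵒᵖ N] [AddCommGroup N']
    [Module Rᵐᵒᵖ N'] (g : N →ₗ[Rᵐᵒᵖ] N') :
    RightModFunctor.Hom (R := R) (quasiCoherentRight N) (quasiCoherentRight N') where
  app S :=
    { toFun := BalTensor.map g LinearMap.id
      map_add' := map_add _
      map_smul' := fun t x => by
        refine DFunLike.congr_fun
          (f := (BalTensor.map g LinearMap.id).comp
            (BalTensor.map LinearMap.id (DistribSMul.toLinearMap R S.right t)))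
          (g := (BalTensor.map LinearMap.id (DistribSMul.toLinearMap R S.right t)).comp
            (BalTensor.map g LinearMap.id))
          (BalTensor.hom_ext fun n m => ?_) x
        simp }
  naturality {S T} f x := by
    refine DFunLike.congr_fun
      (f := (BalTensor.map g LinearMap.id).comp (BalTensor.map LinearMap.id (RAlg.homLeft f)))
      (g := (BalTensor.map LinearMap.id (RAlg.homLeft f)).comp (BalTensor.map g LinearMap.id))
      (BalTensor.hom_ext fun n m => ?_) x
    simp

theorem quasiCoherentRightMap_id {N : Type u} [AddCommGroup N] [Module Rᵐᵒᵖ N]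
    (F : RightModFunctor.{u, v} R) (φ : F.Hom (quasiCoherentRight N)) :
    (quasiCoherentRightMap LinearMap.id).comp φ = φ :=
  RightModFunctor.Hom.ext (funext fun S => LinearMap.ext fun x =>
    DFunLike.congr_fun (BalTensor.map_id (R := R) (N := N) (M := S.right)) (φ.app S x))

theorem quasiCoherentRightMap_comp {N N' N'' : Type u} [AddCommGroup N] [Module Rᵐᵒᵖ N]
    [AddCommGroup N'] [Module Rᵐᵒᵖ N'] [AddCommGroup N''] [Module Rᵐᵒᵖ N'']
    (g' : N' →ₗ[Rᵐᵒᵖ] N'') (g : N →ₗ[Rᵐᵒᵖ] N')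
    (F : RightModFunctor.{u, v} R) (φ : F.Hom (quasiCoherentRight N)) :
    (quasiCoherentRightMap (g' ∘ₗ g)).comp φ =
      (quasiCoherentRightMap g').comp ((quasiCoherentRightMap g).comp φ) :=
  RightModFunctor.Hom.ext (funext fun S => LinearMap.ext fun x =>
    DFunLike.congr_fun (BalTensor.map_comp (R := R) g' g LinearMap.id LinearMap.id) (φ.app S x))

theorem quasiCoherentRightMap_comp_add {N N' : Type u} [AddCommGroup N] [Module Rᵐᵒᵖ N]
    [AddCommGroup N'] [Module Rᵐᵒᵖ N'] (g : N →ₗ[Rᵐᵒᵖ] N')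
    (F : RightModFunctor.{u, v} R) (φ ψ : F.Hom (quasiCoherentRight N)) :
    (quasiCoherentRightMap g).comp (φ + ψ) =
      (quasiCoherentRightMap g).comp φ + (quasiCoherentRightMap g).comp ψ :=
  RightModFunctor.Hom.ext (funext fun S => LinearMap.ext fun x =>
    map_add ((quasiCoherentRightMap g).app S) (φ.app S x) (ψ.app S x))

theorem quasiCoherentRightMap_add_comp {N N' : Type u} [AddCommGroup N] [Module Rᵐᵒᵖ N]
    [AddCommGroup N'] [Module Rᵐᵒᵖ N'] (g g' : N →ₗ[Rᵐᵒᵖ] N')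
    (F : RightModFunctor.{u, v} R) (φ : F.Hom (quasiCoherentRight N)) :
    (quasiCoherentRightMap (g + g')).comp φ =
      (quasiCoherentRightMap g).comp φ + (quasiCoherentRightMap g').comp φ :=
  RightModFunctor.Hom.ext (funext fun S => LinearMap.ext fun x =>
    DFunLike.congr_fun (BalTensor.map_add_left (R := R) g g' LinearMap.id) (φ.app S x))

/-- The left `S`-module structure on the group of morphisms of functors of right `𝓡`-modules
`F → 𝓢`, induced by the left multiplications `s· : S → S`, i.e. `s • φ = (s·) ∘ φ`. -/
instance dualModule (F : RightModFunctor.{u, v} R) (S : RAlg R) :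
    Module S.right (F.Hom (quasiCoherentRight S.right)) where
  smul s φ := (quasiCoherentRightMap (RAlg.mulLeft S s)).comp φ
  one_smul φ := by
    have h : RAlg.mulLeft S 1 = LinearMap.id := by ext; simp
    change (quasiCoherentRightMap (RAlg.mulLeft S 1)).comp φ = φ
    rw [h, quasiCoherentRightMap_id]
  mul_smul s t φ := by
    have h : RAlg.mulLeft S (s * t) = RAlg.mulLeft S s ∘ₗ RAlg.mulLeft S t := by
      ext; simp [mul_assoc]
    change (quasiCoherentRightMap (RAlg.mulLeft S (s * t))).comp φ = _
    rw [h, quasiCoherentRightMap_comp]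
    rfl
  smul_zero s := by
    have h := quasiCoherentRightMap_comp_add (RAlg.mulLeft S s) F 0 0
    rw [add_zero] at h
    exact left_eq_add.1 h
  smul_add s φ ψ := quasiCoherentRightMap_comp_add _ F φ ψ
  add_smul s t φ := by
    have h : RAlg.mulLeft S (s + t) = RAlg.mulLeft S s + RAlg.mulLeft S t := by
      ext; simp [add_mul]
    change (quasiCoherentRightMap (RAlg.mulLeft S (s + t))).comp φ = _
    rw [h, quasiCoherentRightMap_add_comp]
    rfl
  zero_smul φ := by
    have h0 : RAlg.mulLeft S 0 = 0 := by ext; simp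
    change (quasiCoherentRightMap (RAlg.mulLeft S 0)).comp φ = 0
    have h := quasiCoherentRightMap_add_comp (0 : S.right →ₗ[Rᵐᵒᵖ] S.right) 0 F φ
    rw [add_zero] at h
    rw [h0]
    exact left_eq_add.1 h

/-- The dual `F^∨` of a functor of right `𝓡`-modules `F`: the functor of left `𝓡`-modules
`F^∨(S) = Hom_𝓡(F, 𝓢)`, where `𝓢` is the quasi-coherent right `𝓡`-module associated with `S`. -/
def dual (F : RightModFunctor.{u, v} R) : ModFunctor.{u, max (u + 1) v} R where
  toFunctor :=
    { obj := fun S => AddCommGrpCat.of (F.Hom (quasiCoherentRight S.right))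
      map := fun f => AddCommGrpCat.ofHom
        (AddMonoidHom.mk' (fun φ => (quasiCoherentRightMap (RAlg.homRight f)).comp φ)
          (quasiCoherentRightMap_comp_add _ F))
      map_id := fun S => by
        ext1
        refine AddMonoidHom.ext fun φ => ?_
        exact quasiCoherentRightMap_id F φ
      map_comp := fun f g => by
        ext1
        refine AddMonoidHom.ext fun φ => ?_
        exact quasiCoherentRightMap_comp (RAlg.homRight g) (RAlg.homRight f) F φ }
  module S := dualModule F S
  map_smul {S T} f s φ := by
    have h : RAlg.homRight f ∘ₗ RAlg.mulLeft S s =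
        RAlg.mulLeft T (f.right.hom s) ∘ₗ RAlg.homRight f := by
      ext; simp
    change (quasiCoherentRightMap (RAlg.homRight f)).comp
        ((quasiCoherentRightMap (RAlg.mulLeft S s)).comp φ) =
      (quasiCoherentRightMap (RAlg.mulLeft T (f.right.hom s))).comp
        ((quasiCoherentRightMap (RAlg.homRight f)).comp φ)
    rw [← quasiCoherentRightMap_comp, ← quasiCoherentRightMap_comp, h]

/-- A functor of `𝓡`-modules is a module scheme if it is isomorphic to `𝓝^∨` for some right
`R`-module `N`. -/
def IsModuleScheme (F : ModFunctor.{u, v} R) : Prop :=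
  ∃ N : ModuleCat.{u} Rᵐᵒᵖ, Nonempty (F.Iso (dual (quasiCoherentRight (R := R) N)))

end Functors

/-! ### The `R`-algebra `R⟨N⟩` generated by a right `R`-module `N` -/

section FreeAlg

variable {R : Type u} [Ring R]

/-- The relations defining `R⟨N⟩` inside the tensor ring over `ℤ` of `R ⊕ N`: the map from `R` is
unital and multiplicative, and `n · r` in the ring is the product `n r` in the module. -/
inductive FreeRel (R : Type u) [Ring R] (N : Type u) [AddCommGroup N] [Module Rᵐᵒᵖ N] :
    TensorAlgebra ℤ (R × N) → TensorAlgebra ℤ (R × N) → Prop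
  | one : FreeRel R N (TensorAlgebra.ι ℤ ((1, 0) : R × N)) 1
  | mul (r s : R) : FreeRel R N (TensorAlgebra.ι ℤ ((r * s, 0) : R × N))
      (TensorAlgebra.ι ℤ ((r, 0) : R × N) * TensorAlgebra.ι ℤ ((s, 0) : R × N))
  | smul (n : N) (r : R) : FreeRel R N (TensorAlgebra.ι ℤ ((0, op r • n) : R × N))
      (TensorAlgebra.ι ℤ ((0, n) : R × N) * TensorAlgebra.ι ℤ ((r, 0) : R × N))

/-- The structure map `R → R⟨N⟩`. -/
def freeAlgebraMap (R : Type u) [Ring R] (N : Type u) [AddCommGroup N] [Module Rᵐᵒᵖ N] :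
    R →+* RingQuot (FreeRel R N) where
  toFun r := RingQuot.mkRingHom _ (TensorAlgebra.ι ℤ ((r, 0) : R × N))
  map_one' := by rw [RingQuot.mkRingHom_rel FreeRel.one, map_one]
  map_mul' r s := by rw [RingQuot.mkRingHom_rel (FreeRel.mul r s), map_mul]
  map_zero' := by rw [← Prod.zero_eq_mk, map_zero, map_zero]
  map_add' r s := by rw [← map_add, ← map_add, Prod.mk_add_mk, add_zero]

/-- The `R`-algebra `R⟨N⟩` generated by the right `R`-module `N`, that is, the tensor ring of the
`R`-bimodule `R ⊗_ℤ N`, presented by generators and relations. -/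
def freeAlg (N : Type u) [AddCommGroup N] [Module Rᵐᵒᵖ N] : RAlg R :=
  Under.mk (Y := RingCat.of (RingQuot (FreeRel R N))) (RingCat.ofHom (freeAlgebraMap R N))

/-- The canonical right `R`-linear map `N → R⟨N⟩`. -/
def freeι (N : Type u) [AddCommGroup N] [Module Rᵐᵒᵖ N] :
    N →ₗ[Rᵐᵒᵖ] (freeAlg (R := R) N).right where
  toFun n := (RingQuot.mkRingHom (FreeRel R N) (TensorAlgebra.ι ℤ ((0, n) : R × N)) :)
  map_add' n n' := by
    have h : ((0, n + n') : R × N) = (0, n) + (0, n') := by simp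
    rw [h, map_add, map_add]
    rfl
  map_smul' r n := by
    obtain ⟨r, rfl⟩ := op_surjective r
    rw [RingQuot.mkRingHom_rel (FreeRel.smul n r), map_mul]
    rfl

/-- The morphism of `R`-algebras `R⟨N⟩ → S` induced by a right `R`-linear map `N → S`. -/
def freeLift {N : Type u} [AddCommGroup N] [Module Rᵐᵒᵖ N] (S : RAlg R)
    (g : N →ₗ[Rᵐᵒᵖ] S.right) : freeAlg (R := R) N ⟶ S :=
  Under.homMk
    (RingCat.ofHom (RingQuot.lift
      ⟨(TensorAlgebra.lift ℤ
          ((RAlg.algMap S).toAddMonoidHom.coprod g.toAddMonoidHom).toIntLinearMap :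
          TensorAlgebra ℤ (R × N) →+* S.right), by
        intro x y h
        induction h with
        | one => simp
        | mul r s => simp
        | smul n r => simp [RAlg.op_smul_def]⟩))
    (by
      ext r
      change RingQuot.lift _ (RingQuot.mkRingHom _ _) = _
      rw [RingQuot.lift_mkRingHom_apply]
      simp
      rfl)

theorem freeLift_ι {N : Type u} [AddCommGroup N] [Module Rᵐᵒᵖ N] (S : RAlg R)
    (g : N →ₗ[Rᵐᵒᵖ] S.right) (n : N) : (freeLift S g).right.hom (freeι N n) = g n := by
  change RingQuot.lift _ (RingQuot.mkRingHom _ _) = _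
  rw [RingQuot.lift_mkRingHom_apply]
  simp

theorem freeAlg_hom_ext {N : Type u} [AddCommGroup N] [Module Rᵐᵒᵖ N] {S : RAlg R}
    {f g : freeAlg (R := R) N ⟶ S}
    (h : ∀ n, f.right.hom (freeι N n) = g.right.hom (freeι N n)) : f = g := by
  have hR : ∀ r : R, f.right.hom (RAlg.algMap (freeAlg (R := R) N) r) =
      g.right.hom (RAlg.algMap (freeAlg (R := R) N) r) := fun r => by
    rw [RAlg.hom_comm, RAlg.hom_comm]
  have key : ∀ x : TensorAlgebra ℤ (R × N),
      f.right.hom (RingQuot.mkRingHom (FreeRel R N) x :) =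
        g.right.hom (RingQuot.mkRingHom (FreeRel R N) x :) := by
    let F : TensorAlgebra ℤ (R × N) →+* S.right :=
      (f.right.hom : _ →+* S.right).comp (RingQuot.mkRingHom (FreeRel R N))
    let G : TensorAlgebra ℤ (R × N) →+* S.right :=
      (g.right.hom : _ →+* S.right).comp (RingQuot.mkRingHom (FreeRel R N))
    have hFG : F.toIntAlgHom = G.toIntAlgHom := by
      apply TensorAlgebra.hom_ext
      apply LinearMap.ext
      rintro ⟨r, n⟩
      have e : ((r, n) : R × N) = (r, 0) + (0, n) := by simp
      rw [e, map_add, map_add]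
      exact congrArg₂ _ (hR r) (h n)
    exact fun x => DFunLike.congr_fun hFG x
  ext x
  obtain ⟨y, rfl⟩ := RingQuot.mkRingHom_surjective (FreeRel R N) x
  exact key y

/-- The universal property `Hom_{R-alg}(R⟨N⟩, S) = Hom_R(N, S)`. -/
def freeEquiv (N : Type u) [AddCommGroup N] [Module Rᵐᵒᵖ N] (S : RAlg R) :
    (freeAlg (R := R) N ⟶ S) ≃ (N →ₗ[Rᵐᵒᵖ] S.right) where
  toFun f := RAlg.homRight f ∘ₗ freeι N
  invFun g := freeLift S g
  left_inv _ := freeAlg_hom_ext fun n => freeLift_ι S _ n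
  right_inv g := LinearMap.ext fun n => freeLift_ι S g n

/-- The morphism `R⟨w⟩ : R⟨N⟩ → R⟨N'⟩` induced by a right `R`-linear map `w : N → N'`. -/
def freeMap {N N' : Type u} [AddCommGroup N] [Module Rᵐᵒᵖ N] [AddCommGroup N'] [Module Rᵐᵒᵖ N']
    (g : N →ₗ[Rᵐᵒᵖ] N') : freeAlg (R := R) N ⟶ freeAlg (R := R) N' :=
  freeLift _ (freeι N' ∘ₗ g)

/-- The element `x` of `R⟨N ⊕ xR⟩`. -/
def freeX (R : Type u) [Ring R] (N : Type u) [AddCommGroup N] [Module Rᵐᵒᵖ N] :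
    (freeAlg (R := R) (N × R)).right :=
  freeι (N × R) (0, 1)

/-- The morphism `in : R⟨N⟩ → R⟨N ⊕ xR⟩`, `n ↦ n`. -/
def freeIn (R : Type u) [Ring R] (N : Type u) [AddCommGroup N] [Module Rᵐᵒᵖ N] :
    freeAlg (R := R) N ⟶ freeAlg (R := R) (N × R) :=
  freeLift _ (freeι (N × R) ∘ₗ LinearMap.inl Rᵐᵒᵖ N R)

/-- The morphism `h_x : R⟨N⟩ → R⟨N ⊕ xR⟩`, `n ↦ x n`. -/
def freeHx (R : Type u) [Ring R] (N : Type u) [AddCommGroup N] [Module Rᵐᵒᵖ N] :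
    freeAlg (R := R) N ⟶ freeAlg (R := R) (N × R) :=
  freeLift _ (RAlg.mulLeft _ (freeX R N) ∘ₗ freeι (N × R) ∘ₗ LinearMap.inl Rᵐᵒᵖ N R)

section

variable {N N' : Type u} [AddCommGroup N] [Module Rᵐᵒᵖ N] [AddCommGroup N'] [Module Rᵐᵒᵖ N']

theorem freeMap_ι (g : N →ₗ[Rᵐᵒᵖ] N') (n : N) :
    (freeMap g).right.hom (freeι (R := R) N n) = freeι N' (g n) :=
  freeLift_ι _ _ _

theorem freeIn_ι (n : N) : (freeIn R N).right.hom (freeι N n) = freeι (N × R) (n, 0) :=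
  freeLift_ι _ _ _

theorem freeHx_ι (n : N) :
    (freeHx R N).right.hom (freeι N n) = freeX R N * freeι (N × R) (n, 0) :=
  freeLift_ι _ _ _

/-- The map `w ⊕ 1 : N ⊕ xR → N' ⊕ xR`. -/
def prodOne (g : N →ₗ[Rᵐᵒᵖ] N') : (N × R) →ₗ[Rᵐᵒᵖ] (N' × R) :=
  LinearMap.prodMap g LinearMap.id

theorem freeMap_x (g : N →ₗ[Rᵐᵒᵖ] N') :
    (freeMap (prodOne g)).right.hom (freeX R N) = freeX R N' := by
  rw [freeX, freeMap_ι]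
  simp [prodOne, freeX]

theorem freeMap_in (g : N →ₗ[Rᵐᵒᵖ] N') :
    freeMap g ≫ freeIn R N' = freeIn R N ≫ freeMap (prodOne g) := by
  apply freeAlg_hom_ext
  intro n
  change (freeIn R N').right.hom ((freeMap g).right.hom (freeι N n)) =
    (freeMap (prodOne g)).right.hom ((freeIn R N).right.hom (freeι N n))
  rw [freeMap_ι, freeIn_ι, freeIn_ι, freeMap_ι]
  simp [prodOne]

theorem freeMap_hx (g : N →ₗ[Rᵐᵒᵖ] N') :
    freeMap g ≫ freeHx R N' = freeHx R N ≫ freeMap (prodOne g) := by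
  apply freeAlg_hom_ext
  intro n
  change (freeHx R N').right.hom ((freeMap g).right.hom (freeι N n)) =
    (freeMap (prodOne g)).right.hom ((freeHx R N).right.hom (freeι N n))
  rw [freeMap_ι, freeHx_ι, freeHx_ι, map_mul, freeMap_x, freeMap_ι]
  simp [prodOne]

end

/-! ### Extension of a functor of `𝓡`-modules to right `R`-modules -/

/-- `F^r(N)`: the kernel of `F(h_x) - x · F(in) : F(R⟨N⟩) → F(R⟨N ⊕ xR⟩)`. -/
def extKer (F : ModFunctor.{u, v} R) (N : Type u) [AddCommGroup N] [Module Rᵐᵒᵖ N] :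
    AddSubgroup (F.toFunctor.obj (freeAlg (R := R) N)) :=
  AddMonoidHom.ker
    ((F.toFunctor.map (freeHx R N)).hom -
      (DistribSMul.toAddMonoidHom (F.toFunctor.obj (freeAlg (R := R) (N × R))) (freeX R N)).comp
        (F.toFunctor.map (freeIn R N)).hom)

theorem mem_extKer (F : ModFunctor.{u, v} R) (N : Type u) [AddCommGroup N] [Module Rᵐᵒᵖ N]
    (y : F.toFunctor.obj (freeAlg (R := R) N)) :
    y ∈ extKer F N ↔ (F.toFunctor.map (freeHx R N)).hom y =
      freeX R N • (F.toFunctor.map (freeIn R N)).hom y := by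
  rw [extKer, AddMonoidHom.mem_ker, AddMonoidHom.sub_apply, sub_eq_zero]
  rfl

theorem map_mem_extKer (F : ModFunctor.{u, v} R) {N N' : Type u} [AddCommGroup N]
    [Module Rᵐᵒᵖ N] [AddCommGroup N'] [Module Rᵐᵒᵖ N'] (g : N →ₗ[Rᵐᵒᵖ] N')
    (y : F.toFunctor.obj (freeAlg (R := R) N)) (hy : y ∈ extKer F N) :
    (F.toFunctor.map (freeMap g)).hom y ∈ extKer F N' := by
  rw [mem_extKer] at hy ⊢
  have e1 := congrArg (fun k => (F.toFunctor.map k).hom y) (freeMap_hx g)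
  have e2 := congrArg (fun k => (F.toFunctor.map k).hom y) (freeMap_in g)
  simp only [Functor.map_comp, AddCommGrpCat.hom_comp, AddMonoidHom.comp_apply] at e1 e2
  rw [e1, e2, hy, F.map_smul, freeMap_x]

/-- The functor of abelian groups `F^r` from right `R`-modules to abelian groups. -/
def extFunctor (F : ModFunctor.{u, v} R) : ModuleCat.{u} Rᵐᵒᵖ ⥤ AddCommGrpCat.{v} where
  obj N := AddCommGrpCat.of (extKer F N)
  map {N N'} g := AddCommGrpCat.ofHom
    (((F.toFunctor.map (freeMap g.hom)).hom.comp (extKer F N).subtype).codRestrict (extKer F N')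
      fun y => map_mem_extKer F g.hom y y.2)
  map_id N := by
    have h : freeMap (R := R) (LinearMap.id : N →ₗ[Rᵐᵒᵖ] N) = 𝟙 _ :=
      freeAlg_hom_ext fun n => freeMap_ι _ n
    ext1
    refine AddMonoidHom.ext fun y => Subtype.ext ?_
    change (F.toFunctor.map (freeMap LinearMap.id)).hom y.1 = y.1
    rw [h, F.toFunctor.map_id]
    rfl
  map_comp {N N' N''} g g' := by
    have h : freeMap (R := R) (g'.hom ∘ₗ g.hom) = freeMap g.hom ≫ freeMap g'.hom :=
      freeAlg_hom_ext fun n => by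
        rw [freeMap_ι]
        change _ = (freeMap g'.hom).right.hom ((freeMap g.hom).right.hom (freeι _ n))
        rw [freeMap_ι, freeMap_ι]
        rfl
    ext1
    refine AddMonoidHom.ext fun y => Subtype.ext ?_
    change (F.toFunctor.map (freeMap (g'.hom ∘ₗ g.hom))).hom y.1 =
      (F.toFunctor.map (freeMap g'.hom)).hom ((F.toFunctor.map (freeMap g.hom)).hom y.1)
    rw [h, F.toFunctor.map_comp]
    rfl

/-- The functor of abelian groups `𝓜_r`, `𝓜_r(N) = N ⊗_R M`. -/
def tensorFunctor (M : Type u) [AddCommGroup M] [Module R M] :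
    ModuleCat.{u} Rᵐᵒᵖ ⥤ AddCommGrpCat.{u} where
  obj N := AddCommGrpCat.of (BalTensor R N M)
  map g := AddCommGrpCat.ofHom (BalTensor.map g.hom LinearMap.id)
  map_id N := by
    ext1
    exact BalTensor.hom_ext fun _ _ => rfl
  map_comp g g' := by
    ext1
    exact BalTensor.hom_ext fun _ _ => rfl

theorem tensor_mem_extKer (M : Type u) [AddCommGroup M] [Module R M] (N : Type u)
    [AddCommGroup N] [Module Rᵐᵒᵖ N] (y : BalTensor R N M) :
    BalTensor.map (freeι (R := R) N) LinearMap.id y ∈ extKer (quasiCoherent M) N := by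
  refine (mem_extKer _ _ _).2 ?_
  refine DFunLike.congr_fun
    (f := (BalTensor.map (RAlg.homRight (freeHx R N)) LinearMap.id).comp
      (BalTensor.map (freeι (R := R) N) (LinearMap.id : M →ₗ[R] M)))
    (g := ((BalTensor.map (RAlg.mulLeft _ (freeX R N)) LinearMap.id).comp
      (BalTensor.map (RAlg.homRight (freeIn R N)) LinearMap.id)).comp
        (BalTensor.map (freeι (R := R) N) (LinearMap.id : M →ₗ[R] M)))
    (BalTensor.hom_ext fun n m => ?_) y
  simp [freeHx_ι, freeIn_ι]

/-- The natural morphism `𝓜_r → 𝓜^r`: on `N` it is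
`N ⊗_R M → 𝓜^r(N) ⊆ R⟨N⟩ ⊗_R M`, `n ⊗ m ↦ n ⊗ m`. -/
def tensorToExt (M : Type u) [AddCommGroup M] [Module R M] :
    tensorFunctor (R := R) M ⟶ extFunctor (quasiCoherent M) where
  app N := AddCommGrpCat.ofHom
    ((BalTensor.map (freeι (R := R) N) LinearMap.id).codRestrict (extKer (quasiCoherent M) N)
      (tensor_mem_extKer M N))
  naturality N N' g := by
    ext1
    refine AddMonoidHom.ext fun y => Subtype.ext ?_
    refine DFunLike.congr_fun
      (f := (BalTensor.map (freeι (R := R) N') LinearMap.id).comp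
        (BalTensor.map g.hom (LinearMap.id : M →ₗ[R] M)))
      (g := (BalTensor.map (RAlg.homRight (freeMap g.hom)) LinearMap.id).comp
        (BalTensor.map (freeι (R := R) N) (LinearMap.id : M →ₗ[R] M)))
      (BalTensor.hom_ext fun n m => ?_) y
    simp [freeMap_ι]

end FreeAlg

end RMod

namespace RMod

namespace BalTensor

variable {R : Type u} [Ring R]

/-! Evaluating a morphism `𝓝 → 𝓢` at the initial `R`-algebra `R` gives `𝓝^∨(S) = Hom_R(N, S)`
(`dualEquiv`), which is also the set of algebra morphisms `R⟨N⟩ → S`. An isomorphism `𝓜 ≅ 𝓝^∨`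
therefore makes `R⟨N⟩` represent `𝓜`, with a universal element `u ∈ R⟨N⟩ ⊗_R M` corresponding to the
inclusion `N → R⟨N⟩`. Both `𝓜(h_x) u` and `x · 𝓜(in) u` correspond to the map `n ↦ x n`, so `u ∈
𝓜^r(N)` (`universalElement_mem_extKer`). Surjectivity of `𝓜_r(N) → 𝓜^r(N)` then writes `u = ∑ nᵢ ⊗
bᵢ`, a finite sum with `nᵢ ∈ N`. Specializing `u` along the algebra morphism given by `g : N → S`
recovers the element of `𝓜(S)` attached to `g` as `∑ g(nᵢ) ⊗ bᵢ` (`map_dualEquiv_app`). For `S = R`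
and the element `1 ⊗ m`, this reads `m = ∑ cᵢ(m) bᵢ` with `cᵢ` linear in `m`: a finite dual basis,
so `M` is finitely generated projective. Conversely, a finite dual basis `(cᵢ, bᵢ)` of `M` makes the
evaluation `S ⊗_R M → Hom_R(M^*, S)` bijective, with inverse `g ↦ ∑ g(cᵢ) ⊗ bᵢ`
(`evalHom_bijective`). It is `S`-linear and natural, hence `𝓜 ≅ (𝓜^*)^∨`, where `𝓜^*` is the functor
of the right module `M^*`. -/

theorem exists_eq_sum_tmul {N : Type v} [AddCommGroup N] [Module Rᵐᵒᵖ N] {M : Type w}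
    [AddCommGroup M] [Module R M] (y : BalTensor R N M) :
    ∃ (k : ℕ) (n : Fin k → N) (m : Fin k → M), y = ∑ i, tmul R (n i) (m i) := by
  obtain ⟨z, rfl⟩ := QuotientAddGroup.mk'_surjective (balancedRel R N M) y
  induction z with
  | zero => exact ⟨0, Fin.elim0, Fin.elim0, rfl⟩
  | tmul n m => exact ⟨1, fun _ => n, fun _ => m, (Fin.sum_univ_one fun _ => tmul R n m).symm⟩
  | add a b ha hb =>
    obtain ⟨k, n, m, h⟩ := ha
    obtain ⟨k', n', m', h'⟩ := hb
    refine ⟨k + k', Fin.append n n', Fin.append m m', ?_⟩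
    rw [map_add, h, h', Fin.sum_univ_add]
    simp only [Fin.append_left, Fin.append_right]
    rfl

end BalTensor

open BalTensor

variable {R : Type u} [Ring R]

/-- `R` as an `R`-algebra. -/
def baseAlg (R : Type u) [Ring R] : RAlg R := Under.mk (𝟙 (RingCat.of R))

/-- The ring underlying the `R`-algebra `R` is `R`. -/
def baseVal (R : Type u) [Ring R] : (baseAlg R).right →+* R := RingHom.id R

/-- The structure map of an `R`-algebra, as a morphism of `R`-algebras. -/
def fromBase (S : RAlg R) : baseAlg R ⟶ S :=
  Under.homMk S.hom (by exact Category.id_comp _)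

/-! ### Pure tensors, typed as elements of `𝓝(S)` and `𝓜(S)` so that the `S`-actions apply. -/

section PureTensors

/-- The pure tensor `n ⊗ s` in `𝓝(S) = N ⊗_R S`. -/
def pureRight {N : Type u} [AddCommGroup N] [Module Rᵐᵒᵖ N] (S : RAlg R) (n : N) (s : S.right) :
    (quasiCoherentRight (R := R) N).toFunctor.obj S := tmul R n s

/-- The pure tensor `s ⊗ m` in `𝓜(S) = S ⊗_R M`. -/
def pureLeft {M : Type u} [AddCommGroup M] [Module R M] (S : RAlg R) (s : S.right) (m : M) :
    (quasiCoherent (R := R) M).toFunctor.obj S := tmul R s m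

variable {N M : Type u} [AddCommGroup N] [Module Rᵐᵒᵖ N] [AddCommGroup M] [Module R M]
  {S T : RAlg R}

theorem pureRight_add_left (n n' : N) (s : S.right) :
    pureRight S (n + n') s = pureRight S n s + pureRight S n' s := add_tmul R n n' s

theorem pureRight_op_smul (n : N) (r : R) (s : S.right) :
    pureRight S (op r • n) s = pureRight S n (RAlg.algMap S r * s) := smul_tmul R n r s

theorem op_smul_pureRight (n : N) (s t : S.right) :
    op t • pureRight S n s = pureRight S n (s * t) := rfl

theorem map_pureRight (f : S ⟶ T) (n : N) (s : S.right) :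
    ((quasiCoherentRight (R := R) N).toFunctor.map f).hom (pureRight S n s) =
      pureRight T n (f.right.hom s) := rfl

theorem pureLeft_add_right (s : S.right) (m m' : M) :
    pureLeft S s (m + m') = pureLeft S s m + pureLeft S s m' := tmul_add R s m m'

theorem pureLeft_smul_right (s : S.right) (r : R) (m : M) :
    pureLeft S s (r • m) = pureLeft S (s * RAlg.algMap S r) m := (smul_tmul R s r m).symm

theorem smul_pureLeft (s t : S.right) (m : M) :
    t • pureLeft S s m = pureLeft S (t * s) m := rfl

theorem pureRight_hom_ext {A : Type*} [AddCommGroup A]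
    {f g : (quasiCoherentRight (R := R) N).toFunctor.obj S →+ A}
    (h : ∀ n s, f (pureRight S n s) = g (pureRight S n s)) : f = g := hom_ext h

theorem pureLeft_hom_ext {A : Type*} [AddCommGroup A]
    {f g : (quasiCoherent (R := R) M).toFunctor.obj S →+ A}
    (h : ∀ s m, f (pureLeft S s m) = g (pureLeft S s m)) : f = g := hom_ext h

theorem quasiCoherentRight_hom_ext {F : RightModFunctor.{u, v} R}
    {φ ψ : (quasiCoherentRight (R := R) N).Hom F}
    (h : ∀ (S : RAlg R) (n : N) (s : S.right),
      φ.app S (pureRight S n s) = ψ.app S (pureRight S n s)) : φ = ψ :=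
  RightModFunctor.Hom.ext <| funext fun S => LinearMap.ext fun x =>
    DFunLike.congr_fun (pureRight_hom_ext (f := (φ.app S).toAddMonoidHom)
      (g := (ψ.app S).toAddMonoidHom) (h S)) x

end PureTensors

/-! ### The identification `𝓝^∨(S) = Hom_R(N, S)`. -/

section DualOfQuasiCoherent

variable {N K : Type u} [AddCommGroup N] [Module Rᵐᵒᵖ N] [AddCommGroup K] [Module Rᵐᵒᵖ K]

theorem quasiCoherentRightMap_app_pureRight (g : N →ₗ[Rᵐᵒᵖ] K) (S : RAlg R) (n : N)
    (s : S.right) :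
    (quasiCoherentRightMap g).app S (pureRight S n s) = pureRight S (g n) s := rfl

/-- The map `K ⊗_R R → K` given by `k ⊗ r ↦ k r`. -/
def unitRight (K : Type u) [AddCommGroup K] [Module Rᵐᵒᵖ K] :
    (quasiCoherentRight (R := R) K).toFunctor.obj (baseAlg R) →+ K :=
  lift (AddMonoidHom.mk' (fun k => AddMonoidHom.mk' (fun r => op (baseVal R r) • k)
      fun r s => by rw [map_add, MulOpposite.op_add, add_smul])
    fun k k' => by ext r; exact smul_add _ _ _)
    fun k r s => (mul_smul (op (baseVal R s)) (op r) k).symm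

theorem unitRight_op_smul (r : (baseAlg R).right)
    (z : (quasiCoherentRight (R := R) K).toFunctor.obj (baseAlg R)) :
    unitRight K (op r • z) = op (baseVal R r) • unitRight K z := by
  refine DFunLike.congr_fun
    (f := (unitRight (R := R) K).comp (DistribSMul.toAddMonoidHom _ (op r)))
    (g := (DistribSMul.toAddMonoidHom K (op (baseVal R r))).comp (unitRight (R := R) K))
    (pureRight_hom_ext fun k s => ?_) z
  exact mul_smul (op (baseVal R r)) (op (baseVal R s)) k

/-- Since `k ⊗ r = k r ⊗ 1` in `K ⊗_R S`, everything coming from `K ⊗_R R` is a tensor with second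
factor `1`. -/
theorem map_fromBase_eq_pureRight (S : RAlg R)
    (z : (quasiCoherentRight (R := R) K).toFunctor.obj (baseAlg R)) :
    ((quasiCoherentRight K).toFunctor.map (fromBase S)).hom z =
      pureRight S (unitRight K z) 1 := by
  refine DFunLike.congr_fun
    (f := ((quasiCoherentRight K).toFunctor.map (fromBase S)).hom)
    (g := (AddMonoidHom.mk' (fun k => pureRight S k 1)
      fun k k' => pureRight_add_left k k' 1).comp (unitRight (R := R) K))
    (pureRight_hom_ext fun k r => ?_) z
  refine Eq.trans ?_ (pureRight_op_smul k (baseVal R r) (1 : S.right)).symm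
  rw [mul_one]
  rfl

/-- The right `R`-linear map `N → K` underlying a morphism `𝓝 → 𝓚`. -/
def homToLinear (φ : (quasiCoherentRight (R := R) N).Hom (quasiCoherentRight K)) :
    N →ₗ[Rᵐᵒᵖ] K where
  toFun n := unitRight K (φ.app (baseAlg R) (pureRight (baseAlg R) n 1))
  map_add' n n' := by rw [pureRight_add_left, map_add, map_add]
  map_smul' r n := by
    obtain ⟨r, rfl⟩ := op_surjective r
    -- `n r ⊗ 1 = n ⊗ r = (n ⊗ 1) r`, so the linearity of `φ` over the algebra `R` applies.
    rw [pureRight_op_smul, mul_one, ← one_mul (RAlg.algMap _ _), ← op_smul_pureRight, map_smul,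
      unitRight_op_smul]
    rfl

theorem homToLinear_quasiCoherentRightMap (g : N →ₗ[Rᵐᵒᵖ] K) :
    homToLinear (quasiCoherentRightMap g) = g :=
  LinearMap.ext fun n => one_smul Rᵐᵒᵖ (g n)

/-- A morphism is determined by its value at `R`: `n ⊗ s = (n ⊗ 1) s`, and `n ⊗ 1` is the image of
an element of `𝓝(R)`, so naturality along `R → S` and `S`-linearity fix the value on `n ⊗ s`. -/
theorem quasiCoherentRightMap_homToLinear
    (φ : (quasiCoherentRight (R := R) N).Hom (quasiCoherentRight K)) :
    quasiCoherentRightMap (homToLinear φ) = φ := by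
  refine quasiCoherentRight_hom_ext fun S n s => ?_
  have h : pureRight S n s = op s • ((quasiCoherentRight (R := R) N).toFunctor.map
      (fromBase S)).hom (pureRight (baseAlg R) n 1) := by
    rw [map_pureRight, map_one, op_smul_pureRight, one_mul]
  rw [quasiCoherentRightMap_app_pureRight, h, map_smul, φ.naturality, map_fromBase_eq_pureRight,
    op_smul_pureRight, one_mul]
  rfl

/-- `𝓝^∨(S) = Hom_R(N, S)`. -/
def dualEquiv (N : Type u) [AddCommGroup N] [Module Rᵐᵒᵖ N] (S : RAlg R) :
    (dual (quasiCoherentRight (R := R) N)).toFunctor.obj S ≃+ (N →ₗ[Rᵐᵒᵖ] S.right) where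
  toFun := homToLinear
  invFun := quasiCoherentRightMap
  left_inv := quasiCoherentRightMap_homToLinear
  right_inv := homToLinear_quasiCoherentRightMap
  map_add' _ _ := LinearMap.ext fun _ => map_add (unitRight (R := R) S.right) _ _

/-- Phrased through the inverse, because `quasiCoherentRightMap` is explicit on pure tensors, where
the two sides agree by definition. -/
theorem map_dualEquiv_symm {S T : RAlg R} (f : S ⟶ T) (g : N →ₗ[Rᵐᵒᵖ] S.right) :
    ((dual (quasiCoherentRight (R := R) N)).toFunctor.map f).hom ((dualEquiv N S).symm g) =
      (dualEquiv N T).symm (RAlg.homRight f ∘ₗ g) :=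
  quasiCoherentRight_hom_ext fun _ _ _ => rfl

theorem smul_dualEquiv_symm {S : RAlg R} (s : S.right) (g : N →ₗ[Rᵐᵒᵖ] S.right) :
    s • (dualEquiv N S).symm g = (dualEquiv N S).symm (RAlg.mulLeft S s ∘ₗ g) :=
  quasiCoherentRight_hom_ext fun _ _ _ => rfl

theorem dualEquiv_smul {S : RAlg R} (s : S.right)
    (φ : (dual (quasiCoherentRight (R := R) N)).toFunctor.obj S) :
    dualEquiv N S (s • φ) = RAlg.mulLeft S s ∘ₗ dualEquiv N S φ := by
  obtain ⟨g, rfl⟩ := (dualEquiv N S).symm.surjective φ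
  rw [smul_dualEquiv_symm, AddEquiv.apply_symm_apply, AddEquiv.apply_symm_apply]

end DualOfQuasiCoherent

/-! ### Finite dual bases. -/

/-- A left module with a finite dual basis is finitely generated and projective. -/
theorem finite_projective_of_dual_basis {M : Type u} [AddCommGroup M] [Module R M] {k : ℕ}
    (c : Fin k → M →ₗ[R] R) (b : Fin k → M) (h : ∀ m, ∑ i, c i m • b i = m) :
    Module.Finite R M ∧ Module.Projective R M := by
  -- The dual basis exhibits `M` as a retract of `R^k`.
  have hs : Fintype.linearCombination R b ∘ₗ LinearMap.pi c = LinearMap.id :=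
    LinearMap.ext fun m => by simp [Fintype.linearCombination_apply, h]
  exact ⟨Module.Finite.of_surjective (Fintype.linearCombination R b) fun m =>
      ⟨LinearMap.pi c m, LinearMap.congr_fun hs m⟩, Module.Projective.of_split _ _ hs⟩

/-- Projectivity splits a surjection `f : R^k → M` by some `g`; the components of `g` and the images
under `f` of the standard basis vectors form a dual basis. -/
theorem exists_dual_basis (M : Type u) [AddCommGroup M] [Module R M] [Module.Finite R M]
    [Module.Projective R M] :
    ∃ (k : ℕ) (c : Fin k → M →ₗ[R] R) (b : Fin k → M), ∀ m, ∑ i, c i m • b i = m := by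
  obtain ⟨k, f, hf⟩ := Module.Finite.exists_fin' R M
  obtain ⟨g, hg⟩ := Module.projective_lifting_property f LinearMap.id hf
  refine ⟨k, fun i => LinearMap.proj i ∘ₗ g, fun i => f (Pi.single i 1), fun m => ?_⟩
  conv_rhs => rw [← LinearMap.id_apply (R := R) m, ← hg]
  simp only [LinearMap.comp_apply, LinearMap.proj_apply, ← map_smul, ← map_sum]
  -- What remains under `f` is the expansion of `g m` in the standard basis of `R^k`.
  congr 1
  ext j
  simp [Finset.sum_apply, Pi.single_apply]

/-! ### From a module scheme to a finitely generated projective module. -/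

section SchemeToProjective

variable {M N : Type u} [AddCommGroup M] [Module R M] [AddCommGroup N] [Module Rᵐᵒᵖ N]
  (e : (quasiCoherent (R := R) M).Iso (dual (quasiCoherentRight (R := R) N)))

/-- The element of `𝓜(R⟨N⟩)` corresponding to the inclusion `N → R⟨N⟩`. -/
def universalElement : (quasiCoherent (R := R) M).toFunctor.obj (freeAlg N) :=
  (e.app (freeAlg N)).symm ((dualEquiv N _).symm (freeι N))

/-- Yoneda: by naturality of `e`, specializing the universal element along `f` corresponds to
restricting `f` to `N`. -/
theorem app_map_universalElement {S : RAlg R} (f : freeAlg N ⟶ S) :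
    e.app S (((quasiCoherent (R := R) M).toFunctor.map f).hom (universalElement e)) =
      (dualEquiv N S).symm (RAlg.homRight f ∘ₗ freeι N) := by
  rw [e.naturality, universalElement, LinearEquiv.apply_symm_apply, map_dualEquiv_symm]

/-- Under `e`, applying `h_x` and applying `x · in` both turn the inclusion of `N` into `n ↦ x n`;
injectivity of `e` transfers this equality to `𝓜`. -/
theorem universalElement_mem_extKer :
    universalElement e ∈ extKer (quasiCoherent (R := R) M) N := by
  rw [mem_extKer]
  apply (e.app _).injective
  rw [map_smul, app_map_universalElement, app_map_universalElement, smul_dualEquiv_symm]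
  congr 1
  ext n
  simp [freeHx_ι, freeIn_ι]

/-- The coordinate function `M → R` attached to `n ∈ N` by an isomorphism `𝓜 ≅ 𝓝^∨`. -/
def coordinate (n : N) : M →ₗ[R] R where
  toFun m := dualEquiv N (baseAlg R) (e.app (baseAlg R) (pureLeft (baseAlg R) 1 m)) n
  map_add' m m' := by
    rw [pureLeft_add_right, map_add, map_add]
    rfl
  map_smul' r m := by
    -- `1 ⊗ r m = r ⊗ m = r (1 ⊗ m)`, so the linearity of `e` at the algebra `R` applies.
    rw [pureLeft_smul_right, one_mul, ← mul_one (RAlg.algMap _ _), ← smul_pureLeft, map_smul,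
      dualEquiv_smul]
    rfl

/-- The map `R ⊗_R M → M` given by `r ⊗ m ↦ r m`. -/
def unitLeft (M : Type u) [AddCommGroup M] [Module R M] :
    (quasiCoherent (R := R) M).toFunctor.obj (baseAlg R) →+ M :=
  lift (AddMonoidHom.mk' (fun r => AddMonoidHom.mk' (fun m : M => baseVal R r • m)
      fun m m' => smul_add _ m m')
    fun r r' => by ext m; exact add_smul (baseVal R r) (baseVal R r') m)
    fun r s m => mul_smul (baseVal R r) s m

theorem unitLeft_pureLeft_one (m : M) :
    unitLeft (R := R) M (pureLeft (baseAlg R) 1 m) = m := one_smul R m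

theorem map_freeLift_map_freeι {S : RAlg R} (g : N →ₗ[Rᵐᵒᵖ] S.right) (y : BalTensor R N M) :
    ((quasiCoherent (R := R) M).toFunctor.map (freeLift S g)).hom
        (BalTensor.map (freeι (R := R) N) LinearMap.id y) =
      BalTensor.map g LinearMap.id y :=
  DFunLike.congr_fun (hom_ext
    (f := (BalTensor.map (RAlg.homRight (freeLift S g)) LinearMap.id).comp
      (BalTensor.map (freeι (R := R) N) LinearMap.id))
    (g := BalTensor.map g (LinearMap.id : M →ₗ[R] M))
    fun n m => by simp [freeLift_ι]) y

/-- Reconstruction formula. If `g : N → S` corresponds to `x`, the algebra morphism `R⟨N⟩ → S`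
extending `g` sends the universal element to `x`; when that element is `∑ nᵢ ⊗ bᵢ`, its image is
also `∑ g(nᵢ) ⊗ bᵢ`. -/
theorem map_dualEquiv_app {y : BalTensor R N M}
    (hy : BalTensor.map (freeι (R := R) N) LinearMap.id y = universalElement e) {S : RAlg R}
    (x : (quasiCoherent (R := R) M).toFunctor.obj S) :
    BalTensor.map (dualEquiv N S (e.app S x)) LinearMap.id y = x := by
  rw [← map_freeLift_map_freeι]
  apply (e.app S).injective
  refine (congrArg (fun ξ => e.app S (((quasiCoherent (R := R) M).toFunctor.map
    (freeLift S (dualEquiv N S (e.app S x)))).hom ξ)) hy).trans ?_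
  rw [app_map_universalElement, AddEquiv.symm_apply_eq]
  exact LinearMap.ext fun n => freeLift_ι _ _ n

theorem finite_projective_of_iso
    (e : (quasiCoherent (R := R) M).Iso (dual (quasiCoherentRight (R := R) N)))
    (hM : IsIso (tensorToExt (R := R) M)) :
    Module.Finite R M ∧ Module.Projective R M := by
  have hbij := ConcreteCategory.bijective_of_isIso
    ((tensorToExt (R := R) M).app (ModuleCat.of Rᵐᵒᵖ N))
  -- Surjectivity of `𝓜_r(N) → 𝓜^r(N)` pulls the universal element back to `N ⊗_R M`; the finite set
  -- of generators comes from here.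
  obtain ⟨y, hy⟩ := hbij.2 ⟨universalElement e, universalElement_mem_extKer e⟩
  have hy' : BalTensor.map (freeι (R := R) N) LinearMap.id y = universalElement e :=
    congrArg Subtype.val hy
  obtain ⟨k, n, b, hk⟩ := exists_eq_sum_tmul (R := R) (N := N) (M := M) y
  refine finite_projective_of_dual_basis (fun i => coordinate e (n i)) b fun m => ?_
  -- The reconstruction formula for `S = R` and `x = 1 ⊗ m`, carried to `M` by `R ⊗_R M → M`, is the
  -- dual basis identity.
  have h := (congrArg (unitLeft (R := R) M)
    (map_dualEquiv_app e hy' (pureLeft (baseAlg R) 1 m))).trans (unitLeft_pureLeft_one m)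
  rw [hk, map_sum] at h
  exact (map_sum (unitLeft (R := R) M) _ _).symm.trans h

end SchemeToProjective

/-! ### From a finitely generated projective module to a module scheme. -/

section ProjectiveToScheme

variable (M : Type u) [AddCommGroup M] [Module R M]

/-- The map `S ⊗_R M → Hom_R(M^*, S)` given by `s ⊗ m ↦ (f ↦ s f(m))`. -/
def evalHom (S : RAlg R) :
    (quasiCoherent (R := R) M).toFunctor.obj S →+ ((M →ₗ[R] R) →ₗ[Rᵐᵒᵖ] S.right) :=
  lift (AddMonoidHom.mk' (fun s => AddMonoidHom.mk' (fun m : M =>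
      { toFun := fun f => s * RAlg.algMap S (f m)
        map_add' := fun f f' => by simp [mul_add]
        map_smul' := fun r f => by
          obtain ⟨r, rfl⟩ := op_surjective r
          simp [RAlg.op_smul_def, mul_assoc] })
      fun m m' => by ext f; simp [mul_add])
    fun s s' => by ext m f; simp [add_mul])
    fun s r m => by ext f; simp [RAlg.op_smul_def, mul_assoc]

variable {M}

theorem evalHom_pureLeft (S : RAlg R) (s : S.right) (m : M) (f : M →ₗ[R] R) :
    evalHom M S (pureLeft S s m) f = s * RAlg.algMap S (f m) := rfl

theorem evalHom_smul (S : RAlg R) (s : S.right)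
    (x : (quasiCoherent (R := R) M).toFunctor.obj S) :
    evalHom M S (s • x) = RAlg.mulLeft S s ∘ₗ evalHom M S x := by
  refine DFunLike.congr_fun
    (f := (evalHom M S).comp (DistribSMul.toAddMonoidHom _ s))
    (g := (AddMonoidHom.mk' (fun g => RAlg.mulLeft S s ∘ₗ g)
      fun g g' => LinearMap.comp_add _ _ _).comp (evalHom M S))
    (pureLeft_hom_ext fun t m => LinearMap.ext fun f => ?_) x
  exact mul_assoc s t _

theorem evalHom_naturality {S T : RAlg R} (f : S ⟶ T)
    (x : (quasiCoherent (R := R) M).toFunctor.obj S) :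
    evalHom M T (((quasiCoherent (R := R) M).toFunctor.map f).hom x) =
      RAlg.homRight f ∘ₗ evalHom M S x := by
  refine DFunLike.congr_fun
    (f := (evalHom M T).comp ((quasiCoherent (R := R) M).toFunctor.map f).hom)
    (g := (AddMonoidHom.mk' (fun g => RAlg.homRight f ∘ₗ g)
      fun g g' => LinearMap.comp_add _ _ _).comp (evalHom M S))
    (pureLeft_hom_ext fun t m => LinearMap.ext fun g => ?_) x
  change f.right.hom t * RAlg.algMap T (g m) = f.right.hom (t * RAlg.algMap S (g m))
  rw [map_mul, RAlg.hom_comm]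

/-- The map `Hom_R(M^*, S) → S ⊗_R M` attached to a dual basis of `M`. -/
def ofDualBasis {k : ℕ} (c : Fin k → M →ₗ[R] R) (b : Fin k → M) (S : RAlg R) :
    ((M →ₗ[R] R) →ₗ[Rᵐᵒᵖ] S.right) →+ (quasiCoherent (R := R) M).toFunctor.obj S :=
  ∑ i, AddMonoidHom.mk' (fun g => pureLeft S (g (c i)) (b i))
    fun g g' => add_tmul R (g (c i)) (g' (c i)) (b i)

theorem ofDualBasis_apply {k : ℕ} (c : Fin k → M →ₗ[R] R) (b : Fin k → M) (S : RAlg R)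
    (g : (M →ₗ[R] R) →ₗ[Rᵐᵒᵖ] S.right) :
    ofDualBasis c b S g = ∑ i, pureLeft S (g (c i)) (b i) := by
  rw [ofDualBasis, AddMonoidHom.finsetSum_apply]
  rfl

/-- The inverse is `g ↦ ∑ g(cᵢ) ⊗ bᵢ`. One composite sends `s ⊗ m` to `∑ s cᵢ(m) ⊗ bᵢ = s ⊗ ∑ cᵢ(m)
bᵢ = s ⊗ m`; the other uses that the `cᵢ` generate the right module `M^*`. -/
theorem evalHom_bijective [Module.Finite R M] [Module.Projective R M] (S : RAlg R) :
    Function.Bijective (evalHom M S) := by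
  obtain ⟨k, c, b, h⟩ := exists_dual_basis (R := R) M
  refine Function.bijective_iff_has_inverse.2
    ⟨ofDualBasis c b S, fun x => ?_, fun g => LinearMap.ext fun f => ?_⟩
  · refine DFunLike.congr_fun (f := (ofDualBasis c b S).comp (evalHom M S))
      (g := AddMonoidHom.id _) (pureLeft_hom_ext fun s m => ?_) x
    rw [AddMonoidHom.comp_apply, ofDualBasis_apply, AddMonoidHom.id_apply]
    simp only [evalHom_pureLeft, ← pureLeft_smul_right]
    conv_rhs => rw [← h m]
    exact (map_sum (AddMonoidHom.mk' (pureLeft S s) (pureLeft_add_right s)) _ _).symm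
  · rw [ofDualBasis_apply, map_sum, LinearMap.sum_apply]
    simp only [evalHom_pureLeft, ← RAlg.op_smul_def, ← map_smul]
    -- By right linearity of `g` the sum is `g(∑ cᵢ · f(bᵢ))`, and `f = ∑ cᵢ · f(bᵢ)` follows by
    -- applying `f` to `m = ∑ cᵢ(m) bᵢ`.
    rw [← map_sum]
    congr 1
    ext m
    conv_rhs => rw [← h m]
    simp

/-- For `M` finitely generated projective, `𝓜` is the dual of the right module `M^*`. -/
noncomputable def quasiCoherentIsoDual (M : Type u) [AddCommGroup M] [Module R M]
    [Module.Finite R M] [Module.Projective R M] :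
    (quasiCoherent (R := R) M).Iso (dual (quasiCoherentRight (R := R) (M →ₗ[R] R))) where
  app S := LinearEquiv.ofBijective
    { toFun := fun x => (dualEquiv _ S).symm (evalHom M S x)
      map_add' := fun x y => by rw [map_add, map_add]
      map_smul' := fun s x => by
        rw [evalHom_smul, RingHom.id_apply, smul_dualEquiv_symm] }
    ((dualEquiv _ S).symm.bijective.comp (evalHom_bijective S))
  naturality {S T} f x := (congrArg (dualEquiv _ T).symm (evalHom_naturality f x)).trans
    (map_dualEquiv_symm f _).symm

end ProjectiveToScheme

end RMod

theorem theorem6p3 {R : Type u} [Ring R] {M : Type u} [AddCommGroup M] [Module R M]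
    (hM : IsIso (RMod.tensorToExt (R := R) M)) :
    (Module.Finite R M ∧ Module.Projective R M) ↔
      RMod.IsModuleScheme (RMod.quasiCoherent (R := R) M) := by
  constructor
  · rintro ⟨_, _⟩
    exact ⟨ModuleCat.of Rᵐᵒᵖ (M →ₗ[R] R), ⟨RMod.quasiCoherentIsoDual M⟩⟩
  · rintro ⟨_, ⟨e⟩⟩
    exact RMod.finite_projective_of_iso e hM
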